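/- **Conventions.** A *border* $(T_n,\mu)$ is a set of $n\ge 0$ points on a vertical line, numbered $1,\dots,n$ from top to bottom, with integers $\mu(1),\dots,\mu(n)$. $\mathrm{NR}(T_n,\mu)$ is the set of fixed-point-free involutions $\rho$ of $\{1,\dots,n\}$ with $\mu(a)-\mu(b)-1=0$ whenever $a<b=\rho(a)$. A *bordered Legendrian graph* $(\mathcal T,\mu)$ is given by its front in a vertical strip, up to planar isotopy: a plane diagram whose only singularities are crossings, left and right cusps and vertices, possibly with base points, together with a Maslov potential $\mu$, an integer on each arc between vertices, cusps and borders which is at a cusp larger by one on the upper arc than on the lower arc (no condition at vertices). Its intersections with the two sides of the strip are the left and right borders $(T_{\mathsf L},\mu_{\mathsf L})$, $(T_{\mathsf R},\mu_{\mathsf R})$. If the right border of $(\mathcal T^1,\mu^1)$ is the left border of $(\mathcal T^2,\mu^2)$, they can be concatenated to $\mathcal T^1\cdot\mathcal T^2$. **Vertices.** Let $v$ be a vertex of type $(\ell,r)$, $n=\ell+r$, with half-edges $1,\dots,\ell$ on the left and $\ell+1,\dots,n$ on the right, each from top to bottom, labels read modulo $n$. For $i\ge 0$ let $n(v,a,i)=\sum_{j=0}^{i-1}n(v,a+j,1)$,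 where, for $1\le a\le n$, $n(v,a,1)$ is $1$ if $a\in\{\ell,n\}$ and $0$ otherwise when $\ell r\ne0$, and is $2$ if $a=n$ and $0$ otherwise when $\ell r=0$. Let $\mathrm{NR}(v)$ be the set of fixed-point-free involutions $\rho$ of $\{1,\dots,n\}$ with $\mu(a)-\mu(b)+n(v,a,b-a)-1=0$ whenever $a<b=\rho(a)$. For $\rho\in\mathrm{NR}(v)$ let $U=\{a: a<\rho(a)\}$, let $L$ be its complement, let $I_v(a)=\{i>0:\mu(a)-\mu(a+i)+n(v,a,i)=0\}$, let $A_\rho(a)=\{b\in U:\rho(b)<\rho(a),\ b-a\in I_v(a)\}$ for $a\in U$, and let $$A_v(\rho)=\sum_{a\in U}|A_\rho(a)|+\sum_{a\in L}|I_v(a)|.$$ The *resolution* of $v$ by $\rho$ replaces a neighbourhood of $v$ by the following front without vertices, some crossings of which are *marked*. From left to right: (1) for each pair $a<\rho(a)\le\ell$, in increasing order of $a$, the strand $a$ descends through the remaining strands between $a$ and $\rho(a)$ in marked crossings and ends in a right cusp with the strand $\rho(a)$; (2) the braid $\beta$, positive and with the minimal number of crossings, all unmarked, which connects each remaining left half-edge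 to the position (among the remaining ones) of its partner on the right; (3) the minimal positive braid $\beta^c$, all crossings marked, such that $\beta\cdot\beta^c$ is the half-twist, followed by its mirror image in a vertical line, with all crossings marked; (4) the mirror image of the construction (1) for the pairs on the right. A *full resolution* $\mathcal T_\Phi$ resolves every vertex $v$ by some $\Phi(v)\in\mathrm{NR}(v)$. **Normal rulings.** A *normal ruling* $\rho=(\Phi,N,S_N)$ of $(\mathcal T,\mu)$ is a $\Phi\in\prod_v\mathrm{NR}(v)$, a set $N$ (the *switches*) of unmarked crossings of $\mathcal T_\Phi$ of two strands of equal potential, and a decomposition $S_N$ of the $0$-resolution of $\mathcal T_\Phi$ along $N$ (each switch replaced by two horizontal strands) into disks such that: each disk is bounded by an upper and a lower strand, which run monotonically to the right without crossing one another and meet in a cusp at each end, unless they end at a border there; on every vertical line that avoids crossings and cusps the disks pair the points so that the pairing belongs to $\mathrm{NR}$ of these points; and at every switch the two strands belong to two different disks, whose intersections with a vertical line near the switch are disjoint or nested. The pairings at the two borders are $\rho|_{\mathsf L}\in \mathrm{NR}(T_{\mathsf L},\mu_{\mathsf L})$ and $\rho|_{\mathsf R}\in\mathrm{NR}(T_{\mathsf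 R},\mu_{\mathsf R})$. Put $A(\rho)=\sum_vA_v(\Phi(v))$ and $\chi(\rho)=\chi(S_N)-\chi(S_N\cap T_{\mathsf R})$, where $\chi(S_N)$ is the number of disks minus the number of switches (the Euler characteristic of the surface obtained by joining the disks by a half-twisted band at each switch) and $\chi(S_N\cap T_{\mathsf R})$ is the number of intervals cut out on the right border. For $\rho_{\mathsf L}\in\mathrm{NR}(T_{\mathsf L},\mu_{\mathsf L})$, $\rho_{\mathsf R}\in\mathrm{NR}(T_{\mathsf R},\mu_{\mathsf R})$ let $\mathbf R(\mathcal T,\mu;\rho_{\mathsf L},\rho_{\mathsf R})$ be the set of normal rulings with $\rho|_{\mathsf L}=\rho_{\mathsf L}$ and $\rho|_{\mathsf R}=\rho_{\mathsf R}$, and $$\langle\rho_{\mathsf L}|R(\mathcal T,\mu;q,z)|\rho_{\mathsf R}\rangle=\sum_{\rho\in\mathbf R(\mathcal T,\mu;\rho_{\mathsf L},\rho_{\mathsf R})}q^{A(\rho)/2}z^{-\chi(\rho)}\in\mathbb Z[q^{\pm1/2},z^{\pm1}].$$ **Theorem.** Let $(\mathcal T,\mu)=(\mathcal T^1,\mu^1)\cdot(\mathcal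 T^2,\mu^2)$ be the concatenation of two bordered Legendrian graphs with Maslov potentials along a common border $(T_n,\mu_n)$, and let $\rho_{\mathsf L}\in\mathrm{NR}(T^1_{\mathsf L},\mu^1_{\mathsf L})$ and $\rho_{\mathsf R}\in\mathrm{NR}(T^2_{\mathsf R},\mu^2_{\mathsf R})$. 1. Restriction to $\mathcal T^1$ and to $\mathcal T^2$ makes the set $\mathbf R(\mathcal T,\mu;\rho_{\mathsf L},\rho_{\mathsf R})$ the pull-back, over $\mathrm{NR}(T_n,\mu_n)$, of the set of normal rulings of $\mathcal T^1$ with left boundary condition $\rho_{\mathsf L}$ and the set of normal rulings of $\mathcal T^2$ with right boundary condition $\rho_{\mathsf R}$: the restrictions $\rho|_{\mathcal T^1}$ and $\rho|_{\mathcal T^2}$ satisfy these boundary conditions and agree on $T_n$, and each pair $(\rho^1,\rho^2)$ of normal rulings with these boundary conditions and $\rho^1|_{\mathsf R}=\rho^2|_{\mathsf L}$ is the pair of restrictions of exactly one $\rho\in\mathbf R(\mathcal T,\mu;\rho_{\mathsf L},\rho_{\mathsf R})$. 2. $$\langle\rho_{\mathsf L}|R(\mathcal T,\mu;q,z)|\rho_{\mathsf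 R}\rangle=\sum_{\rho\in\mathrm{NR}(T_n,\mu_n)}\langle\rho_{\mathsf L}|R(\mathcal T^1,\mu^1;q,z)|\rho\rangle\cdot\langle\rho|R(\mathcal T^2,\mu^2;q,z)|\rho_{\mathsf R}\rangle.$$ -/

import Mathlib

namespace LegendrianGraph

/-! ## Borders and their normal rulings -/

/-- A border `(T_n, μ)`: the Maslov potentials of its `n` points, listed from top to bottom
(so `n` is the length of the list). -/
abbrev Border : Type := List ℤ

/-- `NR(T_n, μ)`: the fixed-point-free involutions `ρ` of the `n` points such that
`|k_{ab}| = μ(a) - μ(b) - 1 = 0` whenever `a < b = ρ(a)`. -/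
def NR (μ : Border) : Type :=
  {ρ : Equiv.Perm (Fin μ.length) // (∀ a, ρ (ρ a) = a) ∧ (∀ a, ρ a ≠ a) ∧
    ∀ a, a < ρ a → μ.get a - μ.get (ρ a) - 1 = 0}

instance (μ : Border) : Finite (NR μ) := inferInstanceAs (Finite (Subtype _))

noncomputable instance (μ : Border) : Fintype (NR μ) := Fintype.ofFinite _

/-- The position paired with the position `i` (positions are numbered from `0`, top to bottom). -/
def NR.partner {μ : Border} (ρ : NR μ) (i : ℕ) : ℕ :=
  if h : i < μ.length then ρ.1 ⟨i, h⟩ else i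

/-! ## Front projections of bordered Legendrian graphs, with Maslov potentials

A regular front is given, up to planar isotopy, by the sequence of its singular columns from
left to right; between two consecutive columns the front consists of disjoint strands.  All the
singular points with one `x`-coordinate lie in one column.  The Maslov potential is recorded by
labelling every strand with its value. -/

/-- The local pieces of a front, with the potentials of their left and right ends (top to bottom).
At a cusp the potential of the upper strand is one more than that of the lower strand; at a
vertex of type `(ℓ, r)` there is no condition.  A strand or a cusp may carry a base point. -/
inductive GraphPiece : Border → Border → Type
  | strand (based : Bool) (m : ℤ) : GraphPiece [m] [m]
  | crossing (m m' : ℤ) : GraphPiece [m, m'] [m', m]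
  | leftCusp (based : Bool) (m : ℤ) : GraphPiece [] [m + 1, m]
  | rightCusp (based : Bool) (m : ℤ) : GraphPiece [m + 1, m] []
  | vertex (l r : Border) : GraphPiece l r

/-- A column: finitely many pieces stacked vertically, listed from top to bottom. -/
inductive Column : Border → Border → Type
  | nil : Column [] []
  | cons {s t s' t' : Border} (p : GraphPiece s t) (c : Column s' t') : Column (s ++ s') (t ++ t')

/-- The front of a bordered Legendrian graph with a Maslov potential, whose left and right
borders, with the induced potentials, are `s` and `t`. -/
inductive Front : Border → Border → Type
  | nil (s : Border) : Front s s
  | cons {s t u : Border} (c : Column s t) (f : Front t u) : Front s u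

/-- Concatenation of fronts along a common border with the same potential. -/
def Front.append {s t : Border} : Front s t → {u : Border} → Front t u → Front s u
  | .nil _, _, g => g
  | .cons c f, _, g => .cons c (f.append g)

/-! ## Fronts of bordered Legendrian links with markings

Base points play no role for rulings and are not recorded here. -/

inductive LinkPiece : Border → Border → Type
  | crossing (marked : Bool) (m m' : ℤ) : LinkPiece [m, m'] [m', m]
  | leftCusp (m : ℤ) : LinkPiece [] [m + 1, m]
  | rightCusp (m : ℤ) : LinkPiece [m + 1, m] []

/-- One crossing or cusp, with horizontal strands above and below it. -/
structure Step (s t : Border) where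
  above : Border
  below : Border
  {src : Border}
  {tgt : Border}
  piece : LinkPiece src tgt
  hs : s = above ++ src ++ below
  ht : t = above ++ tgt ++ below

inductive Link : Border → Border → Type
  | nil (s : Border) : Link s s
  | cons {s t u : Border} (st : Step s t) (f : Link t u) : Link s u

/-- Reflection in a vertical line. -/
def LinkPiece.mirror {s t : Border} : LinkPiece s t → LinkPiece t s
  | .crossing mk m m' => .crossing mk m' m
  | .leftCusp m => .rightCusp m
  | .rightCusp m => .leftCusp m

namespace Step
variable {s t : Border}

def addAbove (a : Border) (st : Step s t) : Step (a ++ s) (a ++ t) where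
  above := a ++ st.above
  below := st.below
  piece := st.piece
  hs := by simpa using congrArg (a ++ ·) st.hs
  ht := by simpa using congrArg (a ++ ·) st.ht

def addBelow (b : Border) (st : Step s t) : Step (s ++ b) (t ++ b) where
  above := st.above
  below := st.below ++ b
  piece := st.piece
  hs := by simpa using congrArg (· ++ b) st.hs
  ht := by simpa using congrArg (· ++ b) st.ht

def mirror (st : Step s t) : Step t s where
  above := st.above
  below := st.below
  piece := st.piece.mirror
  hs := st.ht
  ht := st.hs

/-- A crossing of the two topmost strands. -/
def cross (marked : Bool) (m m' : ℤ) (b : Border) : Step (m :: m' :: b) (m' :: m :: b) where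
  above := []
  below := b
  piece := .crossing marked m m'
  hs := rfl
  ht := rfl

end Step

namespace Link

def append {s t : Border} : Link s t → {u : Border} → Link t u → Link s u
  | .nil _, _, g => g
  | .cons st f, _, g => .cons st (f.append g)

def single {s t : Border} (st : Step s t) : Link s t := .cons st (.nil t)

/-- Horizontal strands, between two borders that are equal. -/
def ofEq {s t : Border} (h : s = t) : Link s t := h ▸ .nil s

def addAbove (a : Border) {s t : Border} : Link s t → Link (a ++ s) (a ++ t)
  | .nil s => .nil (a ++ s)
  | .cons st f => .cons (st.addAbove a) (f.addAbove a)

def addBelow (b : Border) {s t : Border} : Link s t → Link (s ++ b) (t ++ b)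
  | .nil s => .nil (s ++ b)
  | .cons st f => .cons (st.addBelow b) (f.addBelow b)

def mirror {s t : Border} : Link s t → Link t s
  | .nil s => .nil s
  | .cons st f => f.mirror.append (single st.mirror)

/-- The top strand descends through all the strands `S`; all the crossings are marked. -/
def descend (m : ℤ) : (S : Border) → Link (m :: S) (S ++ [m])
  | [] => .nil [m]
  | m' :: S => .cons (.cross true m m' S) ((descend m S).addAbove [m'])

/-- A marked right cusp: below the strands `A`, a strand descends through the strands `S`,
crossing each of them in a marked crossing, and ends in a right cusp with the strand that follows
`S`; the strands `B` stay below. -/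
def markedCusp (A S B : Border) (m : ℤ) :
    Link (A ++ (m + 1) :: (S ++ m :: B)) (A ++ (S ++ B)) :=
  (((descend (m + 1) S).addBelow (m :: B)).append
    (single { above := S, below := B, piece := .rightCusp m,
              hs := by simp, ht := by simp })).addAbove A

section Braid
variable {α : Type} (pot : α → ℤ) (r : α → α → Prop) [DecidableRel r] (marked : Bool)

/-- The positive braid that moves the top strand `x` down to its place in the sorted list `Y`. -/
def insertBraid (x : α) : (Y : List α) →
    Link ((x :: Y).map pot) ((Y.orderedInsert r x).map pot)
  | [] => .nil _
  | y :: Y =>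
    if h : r x y then ofEq (by simp [h])
    else (Link.cons (.cross marked (pot x) (pot y) (Y.map pot))
      ((insertBraid x Y).addAbove [pot y])).append (ofEq (by simp [h]))

/-- The positive braid, minimal in the number of crossings, that sorts the strands `X` with
respect to the order `r`: two strands cross exactly once if `r` does not order them as they
come in `X`, and do not cross otherwise. -/
def sortBraid : (X : List α) → Link (X.map pot) ((X.insertionSort r).map pot)
  | [] => .nil _
  | x :: X =>
    ((sortBraid X).addAbove [pot x]).append (insertBraid pot r marked x (X.insertionSort r))

end Braid
end Link

/-! ## Vertices

The half-edges of a vertex of type `(ℓ, r)` with potentials `l` (on the left, top to bottom) and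
`r` (on the right, top to bottom) are numbered `0, …, n - 1`, `n = ℓ + r`, first the left ones,
then the right ones, each from top to bottom. -/

abbrev HalfEdge (l r : Border) : Type := Fin (l ++ r).length

def halfEdgePot (l r : Border) (a : HalfEdge l r) : ℤ := (l ++ r).get a

/-- The potential at a half-edge whose number is taken modulo `n`. -/
def cyclicPot (l r : Border) (j : ℕ) : ℤ := (l ++ r).getD (j % (l ++ r).length) 0

/-- How often the sector that follows the half-edge `j` (taken modulo `ℓ + r`) in the cyclic order
meets the vertical line through the vertex. -/
def turn (l r j : ℕ) : ℕ :=
  if l * r = 0 then (if j % (l + r) + 1 = l + r then 2 else 0)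
  else if j % (l + r) + 1 = l ∨ j % (l + r) + 1 = l + r then 1 else 0

/-- `n(v, a, i)`. -/
def turns (l r a i : ℕ) : ℕ := ∑ j ∈ Finset.range i, turn l r (a + j)

/-- The degree `|v_{a,i}| = μ(a) - μ(a + i) + n(v, a, i) - 1` of a vertex generator. -/
def vertexDegree (l r : Border) (a i : ℕ) : ℤ :=
  cyclicPot l r a - cyclicPot l r (a + i) + (turns l.length r.length a i : ℤ) - 1

/-- `NR(v)`: the fixed-point-free involutions `ρ` of the half-edges such that
`|v_{a,b-a}| = 0` whenever `a < b = ρ(a)`. -/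
def VertexNR (l r : Border) : Type :=
  {ρ : Equiv.Perm (HalfEdge l r) // (∀ a, ρ (ρ a) = a) ∧ (∀ a, ρ a ≠ a) ∧
    ∀ a, a < ρ a → vertexDegree l r a ((ρ a : ℕ) - a) = 0}

instance (l r : Border) : Finite (VertexNR l r) := inferInstanceAs (Finite (Subtype _))

/-- `I_v(a) = {i > 0 | μ(a) - μ(a + i) + n(v, a, i) = 0}`. -/
def vertexIndices (l r : Border) (a : ℕ) : Set ℕ :=
  {i | 0 < i ∧ cyclicPot l r a - cyclicPot l r (a + i) + (turns l.length r.length a i : ℤ) = 0}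

namespace VertexNR
variable {l r : Border}

open Classical in
/-- `A_v(ρ) = ∑_{a ∈ U} |A_ρ(a)| + ∑_{a ∈ L} |I_v(a)|`, where `U` is the set of all `a < ρ(a)`,
`L` is its complement, and
`A_ρ(a) = {b ∈ U | ρ(b) < ρ(a) and b - a ∈ I_v(a)}`. -/
noncomputable def vertexIndex (ρ : VertexNR l r) : ℕ :=
  ∑ a : HalfEdge l r,
    if a < ρ.1 a then
      {b : HalfEdge l r | b < ρ.1 b ∧ ρ.1 b < ρ.1 a ∧
        a < b ∧ (b : ℕ) - a ∈ vertexIndices l r a}.ncard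
    else (vertexIndices l r a).ncard

/-- The half-edge `a` is paired with a half-edge on the other side of the vertex. -/
def IsThrough (ρ : VertexNR l r) (a : HalfEdge l r) : Prop :=
  ¬ (a.val < l.length ↔ (ρ.1 a).val < l.length)

instance (ρ : VertexNR l r) : DecidablePred ρ.IsThrough :=
  fun _ => inferInstanceAs (Decidable (¬ _))

theorem lt_add_length (a : HalfEdge l r) : a.val < l.length + r.length :=
  lt_of_lt_of_eq a.2 List.length_append

theorem cyclicPot_eq (a : HalfEdge l r) : cyclicPot l r a = halfEdgePot l r a := by
  have h : a.val % (l ++ r).length = a.val := Nat.mod_eq_of_lt a.2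
  simp only [cyclicPot, halfEdgePot, h, List.get_eq_getElem]
  exact List.getD_eq_getElem _ _ a.2

theorem pot_same (ρ : VertexNR l r) {a : HalfEdge l r} (h : a < ρ.1 a) (ht : ¬ ρ.IsThrough a) :
    halfEdgePot l r a = halfEdgePot l r (ρ.1 a) + 1 := by
  have h0 := ρ.2.2.2 a h
  have hlt : a.val < (ρ.1 a).val := h
  have h1 : a.val + ((ρ.1 a).val - a.val) = (ρ.1 a).val := by omega
  have hb := lt_add_length (ρ.1 a)
  have h2 : turns l.length r.length a ((ρ.1 a).val - a.val) = 0 := by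
    refine Finset.sum_eq_zero fun j hj => ?_
    have hj := Finset.mem_range.1 hj
    have hm : (a.val + j) % (l.length + r.length) = a.val + j := Nat.mod_eq_of_lt (by omega)
    simp only [IsThrough, not_not] at ht
    simp only [turn, hm]
    split_ifs with h1 h2 h3 <;> omega
  rw [vertexDegree, h1, cyclicPot_eq, cyclicPot_eq, h2] at h0
  push_cast at h0
  linarith

theorem pot_through (ρ : VertexNR l r) {a : HalfEdge l r} (h : a.val < l.length)
    (ht : ρ.IsThrough a) : halfEdgePot l r a = halfEdgePot l r (ρ.1 a) := by
  have hge : l.length ≤ (ρ.1 a).val := by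
    simpa only [IsThrough, h, true_iff, not_lt] using ht
  have hlt : a.val < (ρ.1 a).val := by omega
  have h0 := ρ.2.2.2 a hlt
  have h1 : a.val + ((ρ.1 a).val - a.val) = (ρ.1 a).val := by omega
  have hb := lt_add_length (ρ.1 a)
  have h3 : l.length * r.length ≠ 0 := Nat.mul_ne_zero (by omega) (by omega)
  have h2 : turns l.length r.length a ((ρ.1 a).val - a.val) = 1 := by
    rw [turns, Finset.sum_eq_single_of_mem (l.length - 1 - a.val)
      (Finset.mem_range.2 (by omega))]
    · have h4 : (a.val + (l.length - 1 - a.val)) = l.length - 1 := by omega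
      have hm : (l.length - 1) % (l.length + r.length) = l.length - 1 :=
        Nat.mod_eq_of_lt (by omega)
      simp only [turn, h4, hm, h3, if_false]
      rw [if_pos (by omega)]
    · intro j hj hne
      have hj := Finset.mem_range.1 hj
      have hm : (a.val + j) % (l.length + r.length) = a.val + j := Nat.mod_eq_of_lt (by omega)
      simp only [turn, hm, h3, if_false]
      rw [if_neg (by omega)]
  rw [vertexDegree, h1, cyclicPot_eq, cyclicPot_eq, h2] at h0
  push_cast at h0
  linarith

theorem not_through_partner (ρ : VertexNR l r) {x : HalfEdge l r} (h : ¬ ρ.IsThrough x) :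
    ¬ ρ.IsThrough (ρ.1 x) := by
  simp only [IsThrough, not_not, ρ.2.1] at h ⊢
  exact h.symm

theorem through_partner (ρ : VertexNR l r) {x : HalfEdge l r} (h : ρ.IsThrough x) :
    ρ.IsThrough (ρ.1 x) := by
  simp only [IsThrough, ρ.2.1] at h ⊢
  exact fun h' => h h'.symm

/-- A list of half-edges on one side, top to bottom, that contains with every half-edge its partner
unless the partner is on the other side. -/
structure IsSide (ρ : VertexNR l r) (X : List (HalfEdge l r)) : Prop where
  sorted : X.Pairwise (· < ·)
  closed : ∀ x ∈ X, ¬ ρ.IsThrough x → ρ.1 x ∈ X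

theorem IsSide.tail {ρ : VertexNR l r} {x : HalfEdge l r} {X : List (HalfEdge l r)}
    (h : ρ.IsSide (x :: X)) (hx : ρ.IsThrough x) : ρ.IsSide X := by
  refine ⟨(List.pairwise_cons.1 h.sorted).2, fun y hy hny => ?_⟩
  rcases List.mem_cons.1 (h.closed y (List.mem_cons_of_mem _ hy) hny) with h1 | h1
  · exact absurd hx (h1 ▸ ρ.not_through_partner hny)
  · exact h1

theorem IsSide.partner {ρ : VertexNR l r} {x : HalfEdge l r} {X : List (HalfEdge l r)}
    (h : ρ.IsSide (x :: X)) (hx : ¬ ρ.IsThrough x) : ρ.1 x ∈ X ∧ x < ρ.1 x := by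
  have h1 : ρ.1 x ∈ X := (List.mem_cons.1 (h.closed x (by simp) hx)).resolve_left (ρ.2.2.1 x)
  exact ⟨h1, (List.pairwise_cons.1 h.sorted).1 _ h1⟩

theorem split_at (X : List (HalfEdge l r)) (y : HalfEdge l r) (h : y ∈ X) :
    X = X.take (X.idxOf y) ++ y :: X.drop (X.idxOf y + 1) := by
  have hlt := List.idxOf_lt_length_iff.2 h
  conv_lhs => rw [← List.take_append_drop (X.idxOf y) X, List.drop_eq_getElem_cons hlt]
  simp

theorem IsSide.remove {ρ : VertexNR l r} {x : HalfEdge l r} {X : List (HalfEdge l r)}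
    (h : ρ.IsSide (x :: X)) (hx : ¬ ρ.IsThrough x) :
    ρ.IsSide (X.take (X.idxOf (ρ.1 x)) ++ X.drop (X.idxOf (ρ.1 x) + 1)) := by
  obtain ⟨hp, -⟩ := h.partner hx
  have hs := split_at X _ hp
  have hsort := (List.pairwise_cons.1 h.sorted).2
  have hnd : X.Nodup := hsort.imp (fun h => ne_of_lt h)
  have hxX : x ∉ X := fun hm => lt_irrefl _ ((List.pairwise_cons.1 h.sorted).1 x hm)
  generalize X.take (X.idxOf (ρ.1 x)) = S at *
  generalize X.drop (X.idxOf (ρ.1 x) + 1) = B at *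
  subst hs
  refine ⟨hsort.sublist (by simp), fun y hy hny => ?_⟩
  have hyX : y ∈ S ++ ρ.1 x :: B := by
    simp only [List.mem_append, List.mem_cons] at hy ⊢; tauto
  have h1 := h.closed y (List.mem_cons_of_mem _ hyX) hny
  have hyne : y ≠ ρ.1 x := by
    rintro rfl
    simp only [List.nodup_append, List.nodup_cons] at hnd
    simp only [List.mem_append] at hy
    grind
  have h2 : ρ.1 y ≠ x := fun he => hyne (by rw [← he, ρ.2.1])
  have h3 : ρ.1 y ≠ ρ.1 x := fun he => hxX (ρ.1.injective he ▸ hyX)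
  simp only [List.mem_append, List.mem_cons] at h1 ⊢
  tauto

/-- The concatenation of the marked cusps for the pairs `x < ρ(x)` of half-edges in `X`, in
increasing order of `x`; the strands `A`, and the half-edges in `X` whose partner is on the
other side, go through. -/
def closing (ρ : VertexNR l r) (A X : List (HalfEdge l r)) (h : ρ.IsSide X) :
    Link ((A ++ X).map (halfEdgePot l r))
      ((A ++ X.filter (fun x => ρ.IsThrough x)).map (halfEdgePot l r)) :=
  match X, h with
  | [], _ => .nil _
  | x :: X, h =>
    if hx : ρ.IsThrough x then
      ((Link.ofEq (by simp)).append (closing ρ (A ++ [x]) X (h.tail hx))).append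
        (Link.ofEq (by simp [hx]))
    else
      have hX := split_at X _ (h.partner hx).1
      (((Link.ofEq (by
          conv_lhs => rw [hX]
          simp [ρ.pot_same (h.partner hx).2 hx])).append
        (Link.markedCusp (A.map (halfEdgePot l r))
          ((X.take (X.idxOf (ρ.1 x))).map (halfEdgePot l r))
          ((X.drop (X.idxOf (ρ.1 x) + 1)).map (halfEdgePot l r))
          (halfEdgePot l r (ρ.1 x)))).append
        ((Link.ofEq (by simp)).append
          (closing ρ A (X.take (X.idxOf (ρ.1 x)) ++ X.drop (X.idxOf (ρ.1 x) + 1))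
            (h.remove hx)))).append
        (Link.ofEq (by
          conv_rhs => rw [hX]
          simp [hx, ρ.not_through_partner hx]))
termination_by X.length
decreasing_by
  · simp
  · have h1 := congrArg List.length hX
    simp only [List.length_append, List.length_cons] at h1 ⊢
    omega

variable (l r) in
/-- The half-edges on the left. -/
def leftSide : List (HalfEdge l r) :=
  List.ofFn fun i : Fin l.length => ⟨i, by simp only [List.length_append]; omega⟩

variable (l r) in
/-- The half-edges on the right. -/
def rightSide : List (HalfEdge l r) :=
  List.ofFn fun i : Fin r.length => ⟨l.length + i, by simp only [List.length_append]; omega⟩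

theorem mem_leftSide {a : HalfEdge l r} : a ∈ leftSide l r ↔ a.val < l.length := by
  simp only [leftSide, List.mem_ofFn]
  exact ⟨fun ⟨i, hi⟩ => hi ▸ i.2, fun h => ⟨⟨a, h⟩, rfl⟩⟩

theorem mem_rightSide {a : HalfEdge l r} : a ∈ rightSide l r ↔ ¬ a.val < l.length := by
  have := lt_add_length a
  simp only [rightSide, List.mem_ofFn]
  refine ⟨fun ⟨i, hi⟩ => by simp [← hi], fun h => ⟨⟨a - l.length, by omega⟩, Fin.ext ?_⟩⟩
  simp only
  omega

theorem map_leftSide : (leftSide l r).map (halfEdgePot l r) = l := by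
  apply List.ext_getElem
  · simp [leftSide]
  · intro i h1 h2
    simp [leftSide, halfEdgePot, List.getElem_append_left h2]

theorem map_rightSide : (rightSide l r).map (halfEdgePot l r) = r := by
  apply List.ext_getElem <;> simp [rightSide, halfEdgePot]

theorem isSide_left (ρ : VertexNR l r) : ρ.IsSide (leftSide l r) where
  sorted := by
    rw [leftSide, List.pairwise_ofFn]
    exact fun _ _ h => h
  closed := fun x hx h => by
    rw [mem_leftSide] at hx ⊢
    exact (not_not.1 h).1 hx

theorem isSide_right (ρ : VertexNR l r) : ρ.IsSide (rightSide l r) where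
  sorted := by
    rw [rightSide, List.pairwise_ofFn]
    exact fun _ _ h => Fin.mk_lt_mk.2 (Nat.add_lt_add_left h _)
  closed := fun x hx h => by
    rw [mem_rightSide] at hx ⊢
    exact fun h' => hx ((not_not.1 h).2 h')

/-- The half-edges on the left, resp. right, whose partner is on the other side. -/
def leftThrough (ρ : VertexNR l r) : List (HalfEdge l r) :=
  (leftSide l r).filter (fun x => ρ.IsThrough x)

def rightThrough (ρ : VertexNR l r) : List (HalfEdge l r) :=
  (rightSide l r).filter (fun x => ρ.IsThrough x)

/-- `leftThrough`, sorted according to the position of the partner. -/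
def sortedThrough (ρ : VertexNR l r) : List (HalfEdge l r) :=
  ρ.leftThrough.insertionSort (fun x y => ρ.1 x ≤ ρ.1 y)

theorem map_sortedThrough (ρ : VertexNR l r) :
    ρ.sortedThrough.map (halfEdgePot l r) = ρ.rightThrough.map (halfEdgePot l r) := by
  have : Std.Total (fun x y : HalfEdge l r => ρ.1 x ≤ ρ.1 y) := ⟨fun _ _ => le_total _ _⟩
  have : IsTrans _ (fun x y : HalfEdge l r => ρ.1 x ≤ ρ.1 y) :=
    ⟨fun _ _ _ h h' => le_trans h h'⟩
  have hperm := List.perm_insertionSort (fun x y => ρ.1 x ≤ ρ.1 y) ρ.leftThrough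
  have hndl : ρ.leftThrough.Nodup :=
    (ρ.isSide_left.sorted.imp (fun h => ne_of_lt h)).filter _
  have hmem : ∀ x, x ∈ ρ.sortedThrough ↔ x.val < l.length ∧ ρ.IsThrough x := fun x => by
    rw [sortedThrough, hperm.mem_iff, leftThrough]
    simp [mem_leftSide]
  have hmap : ρ.sortedThrough.map ρ.1 = ρ.rightThrough := by
    apply List.Perm.eq_of_pairwise (le := (· ≤ ·))
    · exact fun _ _ _ _ => le_antisymm
    · rw [List.pairwise_map]
      exact List.pairwise_insertionSort (fun x y => ρ.1 x ≤ ρ.1 y) ρ.leftThrough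
    · exact (ρ.isSide_right.sorted.filter _).imp le_of_lt
    · refine (List.perm_ext_iff_of_nodup ((hperm.nodup_iff.2 hndl).map ρ.1.injective)
        ((ρ.isSide_right.sorted.imp (fun h => ne_of_lt h)).filter _)).2 fun y => ?_
      simp only [List.mem_map, List.mem_filter, mem_rightSide, decide_eq_true_eq]
      constructor
      · rintro ⟨x, hx, rfl⟩
        have hx' := (hmem x).1 hx
        refine ⟨fun h => hx'.2 ⟨fun _ => h, fun _ => hx'.1⟩, ρ.through_partner hx'.2⟩
      · rintro ⟨hy, hty⟩
        refine ⟨ρ.1 y, (hmem _).2 ⟨?_, ρ.through_partner hty⟩, ρ.2.1 y⟩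
        by_contra h
        exact hty ⟨fun h' => absurd h' hy, fun h' => absurd h' h⟩
  rw [← hmap, List.map_map]
  exact List.map_congr_left fun x hx => ρ.pot_through ((hmem x).1 hx).1 ((hmem x).1 hx).2

/-- The braid `β`: minimal in crossings, connecting the half-edges on the left whose partner is on
the right to the positions of their partners.  Its crossings are not marked. -/
def beta (ρ : VertexNR l r) : Link (ρ.leftThrough.map (halfEdgePot l r))
    (ρ.sortedThrough.map (halfEdgePot l r)) :=
  Link.sortBraid (halfEdgePot l r) (fun x y => ρ.1 x ≤ ρ.1 y) false ρ.leftThrough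

/-- The right complement `β^c`: the positive braid, minimal in crossings, such that `β · β^c` is
the half-twist, which reverses the order of all the strands.  Its crossings are marked. -/
def betaCompl (ρ : VertexNR l r) : Link (ρ.sortedThrough.map (halfEdgePot l r))
    ((ρ.sortedThrough.insertionSort (fun x y => y ≤ x)).map (halfEdgePot l r)) :=
  Link.sortBraid (halfEdgePot l r) (fun x y => y ≤ x) true ρ.sortedThrough

/-- The resolution `(T_{v,ρ}, M_{v,ρ})` of the vertex: marked right cusps for the pairs on the
left; the braid `β · β^c` followed by the mirror image of `β^c`; marked left cusps for the pairs
on the right. -/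
def resolution (ρ : VertexNR l r) : Link l r :=
  (((Link.ofEq map_leftSide.symm).append (ρ.closing [] (leftSide l r) ρ.isSide_left)).append
    ((ρ.beta.append (ρ.betaCompl.append ρ.betaCompl.mirror)).append
      (Link.ofEq ρ.map_sortedThrough))).append
    ((ρ.closing [] (rightSide l r) ρ.isSide_right).mirror.append (Link.ofEq map_rightSide))

end VertexNR

/-! ## Full resolutions -/

/-- The choices of an involution in `NR(v)` for the vertices of a piece. -/
def GraphPiece.Res {s t : Border} : GraphPiece s t → Type
  | .strand _ _ => Unit
  | .crossing _ _ => Unit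
  | .leftCusp _ _ => Unit
  | .rightCusp _ _ => Unit
  | .vertex l r => VertexNR l r

def Column.Res {s t : Border} : Column s t → Type
  | .nil => Unit
  | .cons p c => p.Res × c.Res

/-- `P(T, μ) = ∏_v NR(v)`, the product over all the vertices. -/
def Front.Res {s t : Border} : Front s t → Type
  | .nil _ => Unit
  | .cons c f => c.Res × f.Res

/-- The full resolution `(T_Φ, M_Φ)`, for a piece, a column and a front: each vertex `v` is
replaced by its resolution with respect to `Φ(v)`, and no crossing outside of these is marked. -/
def GraphPiece.resolve {s t : Border} : (p : GraphPiece s t) → p.Res → Link s t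
  | .strand _ m, _ => .nil [m]
  | .crossing m m', _ => .single (.cross false m m' [])
  | .leftCusp _ m, _ =>
    .single { above := [], below := [], piece := .leftCusp m, hs := rfl, ht := rfl }
  | .rightCusp _ m, _ =>
    .single { above := [], below := [], piece := .rightCusp m, hs := rfl, ht := rfl }
  | .vertex _ _, ρ => ρ.resolution

/-- The pieces of a column are moved apart horizontally, the upper ones to the left. -/
def Column.resolve {s t : Border} : (c : Column s t) → c.Res → Link s t
  | .nil, _ => .nil []
  | .cons (t := t) (s' := s') p c, Φ =>
    ((p.resolve Φ.1).addBelow s').append ((c.resolve Φ.2).addAbove t)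

def Front.resolve {s t : Border} : (f : Front s t) → f.Res → Link s t
  | .nil s, _ => .nil s
  | .cons c f, Φ => (c.resolve Φ.1).append (f.resolve Φ.2)

/-- `A(Φ) = ∑_v A_v(Φ(v))`. -/
noncomputable def GraphPiece.index {s t : Border} : (p : GraphPiece s t) → p.Res → ℕ
  | .strand _ _, _ => 0
  | .crossing _ _, _ => 0
  | .leftCusp _ _, _ => 0
  | .rightCusp _ _, _ => 0
  | .vertex _ _, ρ => VertexNR.vertexIndex ρ

noncomputable def Column.index {s t : Border} : (c : Column s t) → c.Res → ℕ
  | .nil, _ => 0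
  | .cons p c, Φ => p.index Φ.1 + c.index Φ.2

noncomputable def Front.index {s t : Border} : (f : Front s t) → f.Res → ℕ
  | .nil _, _ => 0
  | .cons c f, Φ => c.index Φ.1 + f.index Φ.2

/-! ## Normal rulings of links with markings -/

/-- `Cut f u`: the vertical lines that cut `f` away from its singular points, up to isotopy,
where `f` meets the line in the border `u`. -/
inductive Cut : {s t : Border} → Link s t → Border → Type
  | start {s t : Border} (f : Link s t) : Cut f s
  | tail {s t u v : Border} (st : Step s t) {f : Link t u} (c : Cut f v) : Cut (.cons st f) v

/-- The right border, as a cut. -/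
def Cut.last {s t : Border} : (f : Link s t) → Cut f t
  | .nil s => .start (.nil s)
  | .cons st f => .tail st (Cut.last f)

/-- `Occ f st`: the occurrences of the step `st` in `f`. -/
inductive Occ : {s t : Border} → Link s t → {u v : Border} → Step u v → Type
  | head {s t u : Border} (st : Step s t) (f : Link t u) : Occ (.cons st f) st
  | tail {s t u v w : Border} (st : Step s t) {f : Link t u} {st' : Step v w} (e : Occ f st') :
      Occ (.cons st f) st'

/-- The cuts just before and just after an occurrence of a step. -/
def Occ.left {s t u v : Border} {f : Link s t} {st : Step u v} : Occ f st → Cut f u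
  | .head st f => .start (.cons st f)
  | .tail st e => .tail st e.left

def Occ.right {s t u v : Border} {f : Link s t} {st : Step u v} : Occ f st → Cut f v
  | .head st f => .tail st (.start f)
  | .tail st e => .tail st e.right

/-- The crossings and cusps of `f`. -/
structure Event {s t : Border} (f : Link s t) where
  {left : Border}
  {right : Border}
  {step : Step left right}
  occ : Occ f step

/-- An unmarked crossing of degree `0`, i.e. of two strands of equal potential. -/
def LinkPiece.CanSwitch {s t : Border} : LinkPiece s t → Prop
  | .crossing marked m m' => marked = false ∧ m = m'
  | .leftCusp _ => False
  | .rightCusp _ => False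

/-- `p.Continues k sw i j`: when the piece `p` has `k` strands above it and is `0`-resolved
if `sw` holds, the strand at position `i` on its left continues to position `j` on its right. -/
def LinkPiece.Continues {s t : Border} (k : ℕ) (sw : Prop) (i j : ℕ) : LinkPiece s t → Prop
  | .crossing _ _ _ => (sw ∧ j = i) ∨ (¬ sw ∧ j = Equiv.swap k (k + 1) i)
  | .leftCusp _ => j = if i < k then i else i + 2
  | .rightCusp _ => i = if j < k then j else j + 2

/-- The conditions at the singular point itself on the pairings `ρ` and `ρ'` on its left
and on its right: the two strands that meet in a cusp bound the same disk; the two strands at a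
crossing belong to two different disks; at a switch (`sw`) the two disks are not interlaced, i.e.
they are disjoint or nested near the switch. -/
def LinkPiece.Local {s t u v : Border} (k : ℕ) (sw : Prop) (ρ : NR u) (ρ' : NR v) :
    LinkPiece s t → Prop
  | .crossing _ _ _ => ρ.partner k ≠ k + 1 ∧
      (sw → (ρ.partner k < k ∧ k + 1 < ρ.partner (k + 1)) ∨
        (k + 1 < ρ.partner (k + 1) ∧ ρ.partner (k + 1) < ρ.partner k) ∨
        (ρ.partner (k + 1) < ρ.partner k ∧ ρ.partner k < k))
  | .leftCusp _ => ρ'.partner k = k + 1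
  | .rightCusp _ => ρ.partner k = k + 1

/-- The pairings `ρ` and `ρ'` just before and just after the step are restrictions of a
decomposition into disks near the step: two strands that bound the same disk before the step
bound the same disk after the step, and the conditions at the singular point hold. -/
def Step.Passes {u v : Border} (st : Step u v) (sw : Prop) (ρ : NR u) (ρ' : NR v) : Prop :=
  (∀ i j, i < u.length → st.piece.Continues st.above.length sw i j →
    st.piece.Continues st.above.length sw (ρ.partner i) (ρ'.partner j)) ∧
  st.piece.Local st.above.length sw ρ ρ'

/-- A normal ruling `(N, S_N)` of a link with markings: a set `N` of unmarked crossings of degree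
`0`, the switches, and a decomposition `S_N` of the `0`-resolution along `N` into eyes,
half-eyes and parallels.  Each of these is a disk whose boundary consists of an upper and a lower
strand, which run monotonically to the right and do not cross each other, joined at cusps
unless they end at a border.  The decomposition is given by the pairs that the disks cut out on
each cut. -/
structure NormalRuling {s t : Border} (f : Link s t) where
  N : Set (Event f)
  S : ∀ ⦃u : Border⦄, Cut f u → NR u
  canSwitch : ∀ e ∈ N, e.step.piece.CanSwitch
  passes : ∀ e : Event f, e.step.Passes (e ∈ N) (S e.occ.left) (S e.occ.right)

namespace NormalRuling
variable {s t : Border} {f : Link s t}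

/-- The induced involutions at the left and the right border. -/
def left (R : NormalRuling f) : NR s := R.S (.start f)

def right (R : NormalRuling f) : NR t := R.S (.last f)

/-- An intersection of a disk of the decomposition with a cut; it is given by the upper one of
its two end points. -/
structure Slice (R : NormalRuling f) where
  {border : Border}
  cut : Cut f border
  top : Fin border.length
  isTop : top < (R.S cut).1 top

/-- Two slices on consecutive cuts whose upper end points are on the same strand. -/
inductive Adjacent (R : NormalRuling f) : R.Slice → R.Slice → Prop
  | step (e : Event f) (i : Fin e.left.length) (j : Fin e.right.length)
      (hi : i < (R.S e.occ.left).1 i) (hj : j < (R.S e.occ.right).1 j)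
      (h : e.step.piece.Continues e.step.above.length (e ∈ R.N) i j) :
      R.Adjacent ⟨e.occ.left, i, hi⟩ ⟨e.occ.right, j, hj⟩

/-- The disks (eyes, half-eyes and parallels) of the decomposition. -/
def Disk (R : NormalRuling f) : Type := Quot R.Adjacent

/-- The Euler characteristic of the ruling surface, which is obtained from the disks by joining
them with one half-twisted band at each switch. -/
noncomputable def surfaceEuler (R : NormalRuling f) : ℤ := Nat.card R.Disk - R.N.ncard

/-- `χ(ρ) = χ(S_N) - χ(ι_R^* S_N)`, where `ι_R^* S_N` is the union of the intervals that the ruling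
surface cuts out on the right border. -/
noncomputable def euler (R : NormalRuling f) : ℤ :=
  R.surfaceEuler - Nat.card {i : Fin t.length // i < R.right.1 i}

end NormalRuling

/-! ## Finiteness -/

theorem finite_cuts {s t : Border} (f : Link s t) : Finite (Σ u, Cut f u) := by
  induction f with
  | nil s =>
    refine Finite.of_surjective (fun _ : Unit => (⟨s, .start _⟩ : Σ u, Cut (.nil s) u)) ?_
    rintro ⟨u, c⟩
    cases c
    exact ⟨(), rfl⟩
  | @cons s t u st f ih =>
    refine Finite.of_surjective (fun o : Option (Σ u, Cut f u) => (match o with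
      | none => ⟨s, .start _⟩
      | some c => ⟨c.1, .tail st c.2⟩ : Σ u, Cut (.cons st f) u)) ?_
    rintro ⟨u, c⟩
    cases c with
    | start => exact ⟨none, rfl⟩
    | tail _ c => exact ⟨some ⟨_, c⟩, rfl⟩

instance {s t : Border} (f : Link s t) : Finite (Event f) := by
  induction f with
  | nil s =>
    refine Finite.of_surjective (fun x : Empty => x.elim) ?_
    rintro ⟨e⟩
    cases e
  | @cons s t u st f ih =>
    refine Finite.of_surjective (fun o : Option (Event f) => (match o with
      | none => ⟨.head st f⟩
      | some e => ⟨.tail st e.occ⟩ : Event (.cons st f))) ?_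
    rintro ⟨e⟩
    cases e with
    | head => exact ⟨none, rfl⟩
    | tail _ e => exact ⟨some ⟨e⟩, rfl⟩

instance {s t : Border} (f : Link s t) : Finite (NormalRuling f) := by
  have := finite_cuts f
  refine Finite.of_injective (β := Set (Event f) × ((c : Σ u, Cut f u) → NR c.1))
    (fun R => (R.N, fun c => R.S c.2)) ?_
  rintro ⟨N, S, h1, h2⟩ ⟨N', S', h1', h2'⟩ h
  simp only [Prod.mk.injEq] at h
  obtain ⟨rfl, h⟩ := h
  have : S = S' := by
    funext u c
    exact congrFun h ⟨u, c⟩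
  subst this
  rfl

instance {s t : Border} (p : GraphPiece s t) : Finite p.Res := by
  cases p <;> simp only [GraphPiece.Res] <;> infer_instance

instance {s t : Border} (c : Column s t) : Finite c.Res := by
  induction c with
  | nil => exact inferInstanceAs (Finite Unit)
  | cons p c ih => exact inferInstanceAs (Finite (p.Res × c.Res))

instance {s t : Border} (f : Front s t) : Finite f.Res := by
  induction f with
  | nil => exact inferInstanceAs (Finite Unit)
  | cons c f ih => exact inferInstanceAs (Finite (c.Res × f.Res))

/-! ## Rulings and ruling polynomials of bordered Legendrian graphs -/

/-- A normal ruling of a bordered Legendrian graph: a full resolution `T_Φ` and a normal ruling of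
`T_Φ` with its markings. -/
abbrev Ruling {s t : Border} (T : Front s t) : Type := Σ Φ : T.Res, NormalRuling (T.resolve Φ)

/-- The ring `ℤ[q^{±1/2}, z^{±1}]`: the basis element with exponent `(a, b)` is
`q^{a/2} z^b`. -/
abbrev PolyRing : Type := AddMonoidAlgebra ℤ (ℤ × ℤ)

namespace Ruling
variable {s t : Border} {T : Front s t}

def left (R : Ruling T) : NR s := R.2.left

def right (R : Ruling T) : NR t := R.2.right

/-- The weight `q^{A(ρ)/2} z^{-χ(ρ)}`. -/
noncomputable def weight (R : Ruling T) : PolyRing :=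
  AddMonoidAlgebra.single ((T.index R.1 : ℤ), -R.2.euler) 1

end Ruling

/-- `R(T, μ; ρ_L, ρ_R)`: the normal rulings with boundary conditions. -/
abbrev RulingWith {s t : Border} (T : Front s t) (ρL : NR s) (ρR : NR t) : Type :=
  {R : Ruling T // R.left = ρL ∧ R.right = ρR}

noncomputable instance {s t : Border} (T : Front s t) (ρL : NR s) (ρR : NR t) :
    Fintype (RulingWith T ρL ρR) := Fintype.ofFinite _

/-- The ruling polynomial `⟨ρ_L | R(T, μ; q, z) | ρ_R⟩`. -/
noncomputable def rulingPolynomial {s t : Border} (T : Front s t) (ρL : NR s) (ρR : NR t) :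
    PolyRing :=
  ∑ R : RulingWith T ρL ρR, R.1.weight

/-! ## Restriction of rulings to the two parts of a concatenation -/

def Cut.inl {s t u v : Border} {f : Link s t} (g : Link t u) : Cut f v → Cut (f.append g) v
  | .start f => .start (f.append g)
  | .tail st c => .tail st (c.inl g)

def Cut.inr {s t u v : Border} {g : Link t u} : (f : Link s t) → Cut g v → Cut (f.append g) v
  | .nil _, c => c
  | .cons st f, c => .tail st (c.inr f)

def Occ.inl {s t u v w : Border} {f : Link s t} (g : Link t u) {st : Step v w} :
    Occ f st → Occ (f.append g) st
  | .head st f => .head st (f.append g)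
  | .tail st e => .tail st (e.inl g)

def Occ.inr {s t u v w : Border} {g : Link t u} {st : Step v w} :
    (f : Link s t) → Occ g st → Occ (f.append g) st
  | .nil _, e => e
  | .cons st f, e => .tail st (e.inr f)

theorem Occ.left_inl {s t u v w : Border} {f : Link s t} (g : Link t u) {st : Step v w}
    (e : Occ f st) : (e.inl g).left = e.left.inl g := by
  induction e with
  | head => rfl
  | tail st e ih => exact congrArg (Cut.tail st) (ih g)

theorem Occ.right_inl {s t u v w : Border} {f : Link s t} (g : Link t u) {st : Step v w}
    (e : Occ f st) : (e.inl g).right = e.right.inl g := by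
  induction e with
  | head => rfl
  | tail st e ih => exact congrArg (Cut.tail st) (ih g)

theorem Occ.left_inr {s t u v w : Border} {g : Link t u} {st : Step v w}
    (f : Link s t) (e : Occ g st) : (e.inr f).left = e.left.inr f := by
  induction f with
  | nil => rfl
  | cons st f ih => exact congrArg (Cut.tail st) (ih e)

theorem Occ.right_inr {s t u v w : Border} {g : Link t u} {st : Step v w}
    (f : Link s t) (e : Occ g st) : (e.inr f).right = e.right.inr f := by
  induction f with
  | nil => rfl
  | cons st f ih => exact congrArg (Cut.tail st) (ih e)

namespace NormalRuling
variable {s t u : Border} {f : Link s t} {g : Link t u}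

def restrictLeft (R : NormalRuling (f.append g)) : NormalRuling f where
  N := {e : Event f | (⟨e.occ.inl g⟩ : Event (f.append g)) ∈ R.N}
  S _ c := R.S (c.inl g)
  canSwitch e he := R.canSwitch ⟨e.occ.inl g⟩ he
  passes e := by
    have h := R.passes ⟨e.occ.inl g⟩
    rwa [e.occ.left_inl, e.occ.right_inl] at h

def restrictRight (R : NormalRuling (f.append g)) : NormalRuling g where
  N := {e : Event g | (⟨e.occ.inr f⟩ : Event (f.append g)) ∈ R.N}
  S _ c := R.S (c.inr f)
  canSwitch e he := R.canSwitch ⟨e.occ.inr f⟩ he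
  passes e := by
    have h := R.passes ⟨e.occ.inr f⟩
    rwa [e.occ.left_inr, e.occ.right_inr] at h

end NormalRuling

theorem Link.append_assoc {s t u v : Border} (f : Link s t) (g : Link t u) (h : Link u v) :
    (f.append g).append h = f.append (g.append h) := by
  induction f with
  | nil => rfl
  | cons st f ih => exact congrArg (Link.cons st) (ih g)

/-- The restrictions of `Φ ∈ P(T¹ · T², μ)` to the vertices of `T¹` and of `T²`. -/
def Front.resLeft {s t u : Border} : (f : Front s t) → (g : Front t u) → (f.append g).Res → f.Res
  | .nil _, _, _ => ()
  | .cons _ f, g, Φ => (Φ.1, f.resLeft g Φ.2)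

def Front.resRight {s t u : Border} : (f : Front s t) → (g : Front t u) → (f.append g).Res → g.Res
  | .nil _, _, Φ => Φ
  | .cons _ f, g, Φ => f.resRight g Φ.2

theorem Front.resolve_append {s t u : Border} (f : Front s t) (g : Front t u)
    (Φ : (f.append g).Res) : (f.append g).resolve Φ =
      (f.resolve (f.resLeft g Φ)).append (g.resolve (f.resRight g Φ)) := by
  induction f with
  | nil => rfl
  | cons c f ih =>
    exact (congrArg (Link.append (c.resolve Φ.1)) (ih g Φ.2)).trans (Link.append_assoc _ _ _).symm

namespace Ruling
variable {s t u : Border} {T₁ : Front s t} {T₂ : Front t u}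

/-- The restriction of a normal ruling of `T¹ · T²` to `T¹`. -/
def restrictLeft (R : Ruling (T₁.append T₂)) : Ruling T₁ :=
  ⟨T₁.resLeft T₂ R.1, (T₁.resolve_append T₂ R.1 ▸ R.2).restrictLeft⟩

/-- The restriction of a normal ruling of `T¹ · T²` to `T²`. -/
def restrictRight (R : Ruling (T₁.append T₂)) : Ruling T₂ :=
  ⟨T₁.resRight T₂ R.1, (T₁.resolve_append T₂ R.1 ▸ R.2).restrictRight⟩

end Ruling
end LegendrianGraph

open LegendrianGraph

namespace LegendrianGraph

/-! A normal ruling is a choice of resolution at each vertex, a set of crossings and a family of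
pairings, one for each cut, subject to conditions that involve one event (crossing or cusp) and the
two cuts next to it. The resolution of a concatenation is the concatenation of the resolutions, so
each event lies in exactly one part and each cut in at least one; the only cut in both is the common
border. Restriction is therefore injective (`Ruling.restrict_injective`), and two rulings that agree
on the common border glue (`Ruling.exists_glue`).

For the polynomials it remains to see that the weight is multiplicative. The index is a sum over
vertices. The Euler characteristic is defined by counting disks, which is not local: a disk that
crosses the common border is cut into two. But each disk has exactly one right end, either a right
cusp or an interval on the right border, and the intervals on the right border are subtracted in
`euler`. Hence `euler` is the number of right cusps minus the number of switches
(`NormalRuling.euler_eq`), a count of events, and so it is additive.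

Disks are classes of slices under the relation "continues to the next cut". To count them, each
slice is followed to the right: the next slice is unique if it exists, so each class contains
exactly one slice that has none (`card_quot_eq_card_terminal`), and a slice has none exactly at its
right cusp or on the right border (`card_disk`). -/

/-! ## Quotients by deterministic terminating relations -/

/-- The classes of the equivalence generated by a deterministic terminating relation on a finite
type correspond to the terminal elements. -/
theorem card_quot_eq_card_terminal {α : Type*} [Finite α] (r : α → α → Prop) (rank : α → ℕ)
    (hrank : ∀ a b, r a b → rank a < rank b) (hdet : ∀ a b c, r a b → r a c → b = c) :
    Nat.card (Quot r) = Nat.card {a // ∀ b, ¬ r a b} := by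
  -- The rank increases along `r` and the type is finite, so every chain of `r`-steps stops; the
  -- induction in `hex` runs back from the terminal elements.
  have hwf : WellFounded (fun b a => r a b) := by
    have : IsTrans α (fun b a => rank a < rank b) := ⟨fun _ _ _ h h' => lt_trans h' h⟩
    have : Std.Irrefl (fun b a : α => rank a < rank b) := ⟨fun _ => lt_irrefl _⟩
    exact Subrelation.wf (fun h => hrank _ _ h)
      (Finite.wellFounded_of_trans_of_irrefl (fun b a : α => rank a < rank b))
  have hex : ∀ a, ∃ b : {a // ∀ b, ¬ r a b}, Relation.ReflTransGen r a b.1 := fun a => by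
    induction a using hwf.induction with
    | _ a ih =>
      by_cases h : ∃ b, r a b
      · obtain ⟨b, hb⟩ := h
        obtain ⟨c, hc⟩ := ih b hb
        exact ⟨c, .head hb hc⟩
      · exact ⟨⟨a, not_exists.1 h⟩, .refl⟩
  have huniq : ∀ a (b c : {a // ∀ b, ¬ r a b}), Relation.ReflTransGen r a b.1 →
      Relation.ReflTransGen r a c.1 → b = c := fun a b c hb hc => by
    -- Since `r` is deterministic, one of two elements reached from `a` is reached from the other; a
    -- terminal element reaches only itself.
    rcases Relation.ReflTransGen.total_of_right_unique (fun a b c => hdet a b c) hb hc with h | h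
    · rcases h.cases_head with h | ⟨d, hd, -⟩
      · exact Subtype.ext h
      · exact absurd hd (b.2 d)
    · rcases h.cases_head with h | ⟨d, hd, -⟩
      · exact Subtype.ext h.symm
      · exact absurd hd (c.2 d)
  choose last hlast using hex
  refine (Nat.card_congr (Equiv.ofBijective
    (fun a : {a // ∀ b, ¬ r a b} => Quot.mk r a.1) ⟨fun a b h => ?_, fun q => ?_⟩)).symm
  -- The terminal element reached is constant on classes, so it separates distinct terminal elements
  -- in the quotient.
  · have h' := congrArg (Quot.lift last fun x y hxy =>
      huniq x _ _ (hlast x) (.head hxy (hlast y))) h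
    exact (huniq _ _ _ .refl (hlast a)).trans (h'.trans (huniq _ _ _ (hlast b) .refl))
  · induction q using Quot.ind with
    | _ a =>
      refine ⟨last a, ?_⟩
      have : ∀ b, Relation.ReflTransGen r a b → Quot.mk r b = Quot.mk r a := fun b hb => by
        induction hb with
        | refl => rfl
        | tail _ h ih => exact (Quot.sound h).symm.trans ih
      exact this _ (hlast a)

/-! ## Positions of cuts and events -/

/-- The number of events on the left of a cut. -/
def Cut.pos {s t u : Border} {f : Link s t} : Cut f u → ℕ
  | .start _ => 0
  | .tail _ c => c.pos + 1

theorem Occ.pos_right {s t u v : Border} {f : Link s t} {st : Step u v} (e : Occ f st) :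
    e.right.pos = e.left.pos + 1 := by
  induction e with
  | head => rfl
  | tail st e ih => exact congrArg (· + 1) ih

/-- An event is determined by the cut on its left. -/
theorem Event.eq_of_pos_eq {s t : Border} {f : Link s t} (e e' : Event f)
    (h : e.occ.left.pos = e'.occ.left.pos) : e = e' := by
  induction f with
  | nil => obtain ⟨o⟩ := e; cases o
  | cons st f ih =>
    obtain ⟨o⟩ := e
    obtain ⟨o'⟩ := e'
    cases o with
    | head =>
      cases o' with
      | head => rfl
      | tail _ o' => simp [Occ.left, Cut.pos] at h
    | tail _ o =>
      cases o' with
      | head => simp [Occ.left, Cut.pos] at h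
      | tail _ o' =>
        have := ih ⟨o⟩ ⟨o'⟩ (by simpa [Occ.left, Cut.pos] using h)
        cases this
        rfl

/-- Every cut is the right border or lies just before an event. -/
theorem Cut.eq_last_or_left {s t u : Border} {f : Link s t} (c : Cut f u) :
    (⟨u, c⟩ : Σ u, Cut f u) = ⟨t, .last f⟩ ∨
      ∃ e : Event f, (⟨u, c⟩ : Σ u, Cut f u) = ⟨e.left, e.occ.left⟩ := by
  induction c with
  | start f =>
    cases f with
    | nil => exact .inl rfl
    | cons st f => exact .inr ⟨⟨.head st f⟩, rfl⟩
  | tail st c ih =>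
    rcases ih with h | ⟨e, h⟩
    · cases h; exact .inl rfl
    · cases h; exact .inr ⟨⟨.tail st e.occ⟩, rfl⟩

/-- The strict inequality separates terminal slices at cusps from those on the right border and, in
a concatenation, the events of the first part from those of the second. -/
theorem Occ.pos_left_lt_pos_last {s t u v : Border} {f : Link s t} {st : Step u v} (e : Occ f st) :
    e.left.pos < (Cut.last f).pos := by
  induction e with
  | head => exact Nat.succ_pos _
  | tail st e ih => exact Nat.succ_lt_succ ih

/-! ## Partners -/

namespace NR
variable {μ : Border}

theorem partner_lt (ρ : NR μ) {i : ℕ} (h : i < μ.length) : ρ.partner i < μ.length := by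
  rw [partner, dif_pos h]
  exact Fin.is_lt _

theorem partner_val (ρ : NR μ) (i : Fin μ.length) : ρ.partner i = ρ.1 i := by
  rw [partner, dif_pos i.2]

theorem partner_partner (ρ : NR μ) (i : ℕ) : ρ.partner (ρ.partner i) = i := by
  by_cases h : i < μ.length
  · have := ρ.partner_val ⟨i, h⟩
    simp only at this
    rw [this, partner_val, ρ.2.1]
  -- Out of range, `partner` is the identity by its default value.
  · rw [partner, partner, dif_neg h, dif_neg h]

end NR

/-! ## The right end of a disk -/

def LinkPiece.IsRightCusp {s t : Border} : LinkPiece s t → Prop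
  | .crossing _ _ _ => False
  | .leftCusp _ => False
  | .rightCusp _ => True

theorem LinkPiece.Local.partner_eq {s t u v : Border} {p : LinkPiece s t} {k : ℕ} {sw : Prop}
    {ρ : NR u} {ρ' : NR v} (h : p.Local k sw ρ ρ') (hp : p.IsRightCusp) :
    ρ.partner k = k + 1 := by
  cases p with
  | crossing => exact hp.elim
  | leftCusp => exact hp.elim
  | rightCusp => exact h

/-- At a right cusp the left position is given as a function of the right one; this function skips
two positions and is injective. -/
theorem LinkPiece.Continues.right_unique {s t : Border} {p : LinkPiece s t} {k i j j' : ℕ}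
    {sw : Prop} (h : p.Continues k sw i j) (h' : p.Continues k sw i j') : j = j' := by
  cases p with
  | crossing => simp only [Continues] at h h'; grind
  | leftCusp => exact Eq.trans h (Eq.symm h')
  | rightCusp => simp only [Continues] at h h'; grind

namespace Step
variable {u v : Border}

theorem length_left (st : Step u v) :
    u.length = st.above.length + st.src.length + st.below.length := by
  conv_lhs => rw [st.hs]
  simp [add_assoc]

theorem length_right (st : Step u v) :
    v.length = st.above.length + st.tgt.length + st.below.length := by
  conv_lhs => rw [st.ht]
  simp [add_assoc]

theorem top_lt_length (st : Step u v) (h : st.piece.IsRightCusp) :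
    st.above.length < u.length := by
  have := st.length_left
  obtain ⟨above, below, piece, hs, ht⟩ := st
  cases piece with
  | crossing => exact h.elim
  | leftCusp => exact h.elim
  | rightCusp => simp only [List.length_cons, List.length_nil] at this ⊢; omega

/-- The upper strand of a disk continues to the upper strand of a disk, unless the disk ends in a
right cusp. -/
theorem Passes.exists_continues_iff {st : Step u v} {sw : Prop} {ρ : NR u} {ρ' : NR v}
    (h : st.Passes sw ρ ρ') {i : ℕ} (hi : i < u.length) (htop : i < ρ.partner i) :
    (∃ j, j < v.length ∧ j < ρ'.partner j ∧ st.piece.Continues st.above.length sw i j) ↔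
      ¬ (st.piece.IsRightCusp ∧ i = st.above.length) := by
  obtain ⟨hpass, hloc⟩ := h
  have hl := st.length_left
  have hr := st.length_right
  have hp := ρ.partner_lt hi
  have hpp := ρ.partner_partner i
  obtain ⟨above, below, piece, hs, ht⟩ := st
  cases piece with
  | crossing mk m m' =>
    simp only [LinkPiece.Continues, LinkPiece.Local, LinkPiece.IsRightCusp, List.length_cons,
      List.length_nil, false_and, not_false_eq_true, iff_true] at *
    -- At a switch all positions and partners are unchanged.
    by_cases hsw : sw
    · have := hpass i i hi (.inl ⟨hsw, rfl⟩)
      exact ⟨i, by omega, by grind, .inl ⟨hsw, rfl⟩⟩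
    · have := hpass i _ hi (.inr ⟨hsw, rfl⟩)
      refine ⟨_, ?_, ?_, .inr ⟨hsw, rfl⟩⟩
      · rw [Equiv.swap_apply_def]; split_ifs <;> omega
      · rcases this with h1 | ⟨-, h1⟩
        · exact absurd h1.1 hsw
        · rw [h1]
          -- Exchanging two adjacent positions reverses the order of a pair only if the pair
          -- consists of these two; the strands of a crossing bound different disks, so this does
          -- not occur.
          have h2 := hloc.1
          rw [Equiv.swap_apply_def, Equiv.swap_apply_def]
          split_ifs <;> grind
  | leftCusp m =>
    simp only [LinkPiece.Continues, LinkPiece.Local, LinkPiece.IsRightCusp, List.length_cons,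
      List.length_nil, false_and, not_false_eq_true, iff_true] at *
    have := hpass i _ hi rfl
    refine ⟨_, ?_, ?_, rfl⟩
    · split_ifs <;> omega
    · rw [this]; split_ifs <;> omega
  | rightCusp m =>
    simp only [LinkPiece.Continues, LinkPiece.Local, LinkPiece.IsRightCusp, List.length_cons,
      List.length_nil, true_and] at *
    constructor
    · rintro ⟨j, -, -, hj⟩ h
      split_ifs at hj <;> omega
    · intro hne
      -- This is the lower strand at the cusp, whose partner lies above it, so it is not the top of
      -- a disk.
      have hne' : i ≠ above.length + 1 := by
        rintro rfl
        have := ρ.partner_partner above.length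
        rw [hloc] at this
        omega
      -- The continuation of `i` is found by inverting the shift by two below the cusp, which is
      -- possible off its two strands.
      have key : i = if (if i < above.length then i else i - 2) < above.length then
          (if i < above.length then i else i - 2) else
          (if i < above.length then i else i - 2) + 2 := by
        split_ifs <;> omega
      have := hpass i _ hi key
      refine ⟨_, ?_, ?_, key⟩
      · split_ifs <;> omega
      · split_ifs at this ⊢ <;> omega

end Step

namespace NormalRuling
variable {s t : Border} {f : Link s t}

theorem finite_slice (R : NormalRuling f) : Finite R.Slice := by
  have := finite_cuts f
  refine Finite.of_injective
    (fun x : R.Slice => (⟨⟨x.border, x.cut⟩, x.top⟩ : Σ c : (Σ u, Cut f u), Fin c.1.length)) ?_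
  rintro ⟨c, i, hi⟩ ⟨c', i', hi'⟩ h
  cases h
  rfl

/-- The position of the cut is the rank used to count the disks. -/
theorem Adjacent.pos_lt {R : NormalRuling f} {x y : R.Slice} (h : R.Adjacent x y) :
    x.cut.pos < y.cut.pos := by
  obtain ⟨e, i, j, hi, hj, h⟩ := h
  rw [e.occ.pos_right]
  exact Nat.lt_succ_self _

theorem adjacent_iff {R : NormalRuling f} {e : Event f} {i : Fin e.left.length}
    {hi : i < (R.S e.occ.left).1 i} {y : R.Slice} :
    R.Adjacent ⟨e.occ.left, i, hi⟩ y ↔ ∃ (j : Fin e.right.length)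
      (hj : j < (R.S e.occ.right).1 j), y = ⟨e.occ.right, j, hj⟩ ∧
        e.step.piece.Continues e.step.above.length (e ∈ R.N) i j := by
  constructor
  · intro h
    -- The indices of `Adjacent` have to be variables for the case split. The event is then
    -- recovered from the position of its left cut, a natural number, which avoids comparing cuts
    -- over different borders.
    generalize hx : (⟨e.occ.left, i, hi⟩ : R.Slice) = x at h
    obtain ⟨e', i', j', hi', hj', h⟩ := h
    have he : e = e' := e.eq_of_pos_eq e' (congrArg (fun x : R.Slice => x.cut.pos) hx)
    subst he
    have : i = i' := by injection hx
    subst this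
    exact ⟨j', hj', rfl, h⟩
  · rintro ⟨j, hj, rfl, h⟩
    exact .step e i j hi hj h

theorem Adjacent.right_unique {R : NormalRuling f} {x y z : R.Slice} (h : R.Adjacent x y)
    (h' : R.Adjacent x z) : y = z := by
  obtain ⟨e, i, j, hi, hj, h⟩ := h
  obtain ⟨j', hj', rfl, hc⟩ := adjacent_iff.1 h'
  obtain rfl : j = j' := Fin.ext (h.right_unique hc)
  rfl

/-- Translates `Step.Passes.exists_continues_iff` from positions to slices: just before an event,
the only terminal slice is the one that closes up in a right cusp. -/
theorem exists_adjacent_iff (R : NormalRuling f) (e : Event f) (i : Fin e.left.length)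
    (hi : i < (R.S e.occ.left).1 i) :
    (∃ y, R.Adjacent ⟨e.occ.left, i, hi⟩ y) ↔
      ¬ (e.step.piece.IsRightCusp ∧ i.val = e.step.above.length) := by
  rw [← (R.passes e).exists_continues_iff i.2 (by rw [NR.partner_val]; exact hi)]
  constructor
  · rintro ⟨y, h⟩
    obtain ⟨j, hj, -, h⟩ := adjacent_iff.1 h
    exact ⟨j, j.2, by rw [NR.partner_val]; exact hj, h⟩
  · rintro ⟨j, hj, hj', h⟩
    have hj' : (⟨j, hj⟩ : Fin e.right.length) < (R.S e.occ.right).1 ⟨j, hj⟩ := by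
      rw [Fin.lt_def, ← NR.partner_val]; exact hj'
    exact ⟨_, adjacent_iff.2 ⟨⟨j, hj⟩, hj', rfl, h⟩⟩

theorem not_adjacent_last (R : NormalRuling f) (i : Fin t.length) (hi : i < R.right.1 i)
    (y : R.Slice) : ¬ R.Adjacent ⟨.last f, i, hi⟩ y := by
  intro h
  generalize hx : (⟨.last f, i, hi⟩ : R.Slice) = x at h
  obtain ⟨e, i', j', hi', hj', h⟩ := h
  have := congrArg (fun x : R.Slice => x.cut.pos) hx
  exact absurd this e.occ.pos_left_lt_pos_last.ne'

theorem isTop_of_isRightCusp (R : NormalRuling f) {e : Event f} (he : e.step.piece.IsRightCusp) :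
    (⟨e.step.above.length, e.step.top_lt_length he⟩ : Fin e.left.length) <
      (R.S e.occ.left).1 ⟨e.step.above.length, e.step.top_lt_length he⟩ := by
  rw [Fin.lt_def, ← NR.partner_val]
  exact (Nat.lt_succ_self _).trans_eq ((R.passes e).2.partner_eq he).symm

/-- Every disk ends on the right at a right cusp or at the right border. -/
theorem card_disk (R : NormalRuling f) : Nat.card R.Disk =
    {e : Event f | e.step.piece.IsRightCusp}.ncard +
      Nat.card {i : Fin t.length // i < R.right.1 i} := by
  have := R.finite_slice
  rw [Disk, card_quot_eq_card_terminal R.Adjacent (fun x => x.cut.pos) (fun _ _ h => h.pos_lt)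
    (fun _ _ _ h h' => h.right_unique h'), ← Nat.card_coe_set_eq, ← Nat.card_sum]
  -- A right cusp is sent to the slice just before it that starts at its upper strand, an upper end
  -- point on the right border to its slice there.
  refine (Nat.card_congr (Equiv.ofBijective (Sum.elim
    (fun e => ⟨⟨e.1.occ.left, _, R.isTop_of_isRightCusp e.2⟩, fun b hb =>
      (R.exists_adjacent_iff _ _ _).1 ⟨b, hb⟩ ⟨e.2, rfl⟩⟩)
    (fun i => ⟨⟨.last f, i.1, i.2⟩, R.not_adjacent_last i.1 i.2⟩)) ⟨?_, ?_⟩)).symm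
  · rintro (e | i) (e' | i') h
    · exact congrArg Sum.inl (Subtype.ext (e.1.eq_of_pos_eq e'.1
        (congrArg (fun x => x.1.cut.pos) h)))
    · exact absurd (congrArg (fun x => x.1.cut.pos) h) e.1.occ.pos_left_lt_pos_last.ne
    · exact absurd (congrArg (fun x => x.1.cut.pos) h) e'.1.occ.pos_left_lt_pos_last.ne'
    · have := congrArg Subtype.val h
      have h' : i.1 = i'.1 := by injection this
      exact congrArg Sum.inr (Subtype.ext h')
  · rintro ⟨⟨c, i, hi⟩, hx⟩
    -- A terminal slice away from the right border lies just before an event, which must be a right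
    -- cusp that closes it.
    rcases c.eq_last_or_left with h | ⟨e, h⟩
    · cases h
      exact ⟨.inr ⟨i, hi⟩, rfl⟩
    · cases h
      have h := (R.exists_adjacent_iff e i hi).not.1 (not_exists.2 hx)
      rw [not_not] at h
      obtain ⟨i, hi'⟩ := i
      obtain rfl : i = e.step.above.length := h.2
      exact ⟨.inl ⟨e, h.1⟩, rfl⟩

/-- The Euler characteristic is the number of right cusps minus the number of switches. -/
theorem euler_eq (R : NormalRuling f) :
    R.euler = {e : Event f | e.step.piece.IsRightCusp}.ncard - R.N.ncard := by
  -- The intervals on the right border counted by `card_disk` are those that `euler` subtracts.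
  rw [euler, surfaceEuler, card_disk]
  push_cast
  ring

end NormalRuling

/-! ## Events and cuts of a concatenation -/

section Concatenation
variable {s t u : Border} {f : Link s t} {g : Link t u}

def Event.inl (g : Link t u) (e : Event f) : Event (f.append g) := ⟨e.occ.inl g⟩

def Event.inr (f : Link s t) (e : Event g) : Event (f.append g) := ⟨e.occ.inr f⟩

theorem Event.inl_or_inr (f : Link s t) (g : Link t u) (e : Event (f.append g)) :
    (∃ e', e = Event.inl g e') ∨ ∃ e', e = Event.inr f e' := by
  induction f with
  | nil => exact .inr ⟨e, rfl⟩
  | cons st f ih =>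
    obtain ⟨o⟩ := e
    cases o with
    | head => exact .inl ⟨⟨.head st f⟩, rfl⟩
    | tail _ o =>
      rcases ih g ⟨o⟩ with ⟨e', h⟩ | ⟨e', h⟩
      · cases h
        exact .inl ⟨⟨.tail st e'.occ⟩, rfl⟩
      · cases h
        exact .inr ⟨e', rfl⟩

theorem Cut.pos_inl (g : Link t u) {v : Border} (c : Cut f v) : (c.inl g).pos = c.pos := by
  induction c with
  | start => rfl
  | tail st c ih => exact congrArg (· + 1) (ih g)

theorem Cut.pos_inr (f : Link s t) {v : Border} (c : Cut g v) :
    (c.inr f).pos = (Cut.last f).pos + c.pos := by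
  induction f with
  | nil => exact (Nat.zero_add _).symm
  | cons st f ih => exact (congrArg (· + 1) (ih c)).trans (Nat.add_right_comm _ _ _)

theorem Event.inl_injective : Function.Injective (Event.inl (f := f) g) := fun e e' h =>
  e.eq_of_pos_eq e' (by
    have := congrArg (fun e => e.occ.left.pos) h
    simpa only [Event.inl, Occ.left_inl, Cut.pos_inl] using this)

theorem Event.inr_injective : Function.Injective (Event.inr (g := g) f) := fun e e' h =>
  e.eq_of_pos_eq e' (by
    have := congrArg (fun e => e.occ.left.pos) h
    simpa only [Event.inr, Occ.left_inr, Cut.pos_inr, Nat.add_left_cancel_iff] using this)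

/-- Events of `f` start strictly before the position of the common border, events of `g` at or after
it. -/
theorem Event.inl_ne_inr (e : Event f) (e' : Event g) : Event.inl g e ≠ Event.inr f e' := fun h => by
  have := congrArg (fun e => e.occ.left.pos) h
  simp only [Event.inl, Event.inr, Occ.left_inl, Occ.left_inr, Cut.pos_inl, Cut.pos_inr] at this
  have := e.occ.pos_left_lt_pos_last
  omega

/-- The events of a concatenation are the disjoint union of the events of its parts; applied to
right cusps and to switches, this makes `euler` additive. -/
theorem Event.ncard_eq_add (X : Set (Event (f.append g))) :
    X.ncard = (Event.inl g ⁻¹' X).ncard + (Event.inr f ⁻¹' X).ncard := by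
  rw [← Set.ncard_image_of_injective _ (Event.inl_injective (f := f) (g := g)),
    ← Set.ncard_image_of_injective _ (Event.inr_injective (f := f) (g := g)),
    ← Set.ncard_union_eq ?_ (Set.toFinite _) (Set.toFinite _)]
  · congr 1
    ext e
    constructor
    · intro he
      rcases Event.inl_or_inr f g e with ⟨e', rfl⟩ | ⟨e', rfl⟩
      · exact .inl ⟨e', he, rfl⟩
      · exact .inr ⟨e', he, rfl⟩
    · rintro (⟨e', he, rfl⟩ | ⟨e', he, rfl⟩) <;> exact he
  · rw [Set.disjoint_left]
    rintro _ ⟨e, -, rfl⟩ ⟨e', -, h⟩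
    exact Event.inl_ne_inr e e' h.symm

/-- In contrast to events, the alternatives are not exclusive: by `Cut.inl_last` the common border
arises from both sides. -/
theorem Cut.inl_or_inr (f : Link s t) (g : Link t u) {v : Border} (c : Cut (f.append g) v) :
    (∃ c', c = Cut.inl g c') ∨ ∃ c', c = Cut.inr f c' := by
  induction f with
  | nil => exact .inr ⟨c, rfl⟩
  | cons st f ih =>
    cases c with
    | start => exact .inl ⟨.start _, rfl⟩
    | tail _ c =>
      rcases ih g c with ⟨c', rfl⟩ | ⟨c', rfl⟩
      · exact .inl ⟨.tail st c', rfl⟩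
      · exact .inr ⟨c', rfl⟩

theorem Cut.inl_last (f : Link s t) (g : Link t u) : (Cut.last f).inl g = (Cut.start g).inr f := by
  induction f with
  | nil => rfl
  | cons st f ih => exact congrArg (Cut.tail st) (ih g)

theorem Cut.inr_last (f : Link s t) (g : Link t u) : (Cut.last g).inr f = .last (f.append g) := by
  induction f with
  | nil => rfl
  | cons st f ih => exact congrArg (Cut.tail st) (ih g)

/-- A family indexed by the cuts of a concatenation from families on both parts. -/
def Cut.glue {X : Border → Type} {s t u : Border} {g : Link t u} : (f : Link s t) →
    (∀ ⦃v⦄, Cut f v → X v) → (∀ ⦃v⦄, Cut g v → X v) → ∀ ⦃v⦄, Cut (f.append g) v → X v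
  -- At the common border the value is taken from `S₂`; thus `glue_inr` needs no hypothesis, while
  -- `glue_inl` needs agreement on that border.
  | .nil _, _, S₂ => S₂
  | .cons st f, S₁, S₂ => fun v c =>
    match v, c with
    | _, .start _ => S₁ (.start (.cons st f))
    | _, .tail _ c => Cut.glue f (fun _ c => S₁ (.tail st c)) S₂ c

theorem Cut.glue_inr {X : Border → Type} (S₁ : ∀ ⦃v⦄, Cut f v → X v) (S₂ : ∀ ⦃v⦄, Cut g v → X v)
    {v : Border} (c : Cut g v) : Cut.glue f S₁ S₂ (c.inr f) = S₂ c := by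
  induction f with
  | nil => rfl
  | cons st f ih => exact ih (fun _ c => S₁ (.tail st c)) S₂ c

theorem Cut.glue_inl {X : Border → Type} (S₁ : ∀ ⦃v⦄, Cut f v → X v) (S₂ : ∀ ⦃v⦄, Cut g v → X v)
    (h : S₁ (.last f) = S₂ (.start g)) {v : Border} (c : Cut f v) :
    Cut.glue f S₁ S₂ (c.inl g) = S₁ c := by
  induction f with
  | nil => cases c; exact h.symm
  | cons st f ih =>
    cases c with
    | start => rfl
    | tail _ c => exact ih (fun _ c => S₁ (.tail st c)) S₂ h c

end Concatenation

/-! ## Normal rulings of a concatenation of links -/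

namespace NormalRuling
variable {s t u : Border} {f : Link s t} {g : Link t u}

theorem ext' {R R' : NormalRuling f} (hN : R.N = R'.N) (hS : ∀ u (c : Cut f u), R.S c = R'.S c) :
    R = R' := by
  obtain ⟨N, S, h, h'⟩ := R
  obtain ⟨N', S', _, _⟩ := R'
  obtain rfl : N = N' := hN
  obtain rfl : S = S' := by funext u c; exact hS u c
  rfl

theorem left_restrictLeft (R : NormalRuling (f.append g)) : R.restrictLeft.left = R.left := rfl

theorem right_restrictRight (R : NormalRuling (f.append g)) :
    R.restrictRight.right = R.right :=
  congrArg (fun c => R.S c) (Cut.inr_last f g)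

theorem right_restrictLeft (R : NormalRuling (f.append g)) :
    R.restrictLeft.right = R.restrictRight.left :=
  congrArg (fun c => R.S c) (Cut.inl_last f g)

/-- Disks that meet the common border are counted in both parts, so the proof goes through
`euler_eq`, where only events are counted. -/
theorem euler_append (R : NormalRuling (f.append g)) :
    R.euler = R.restrictLeft.euler + R.restrictRight.euler := by
  rw [euler_eq, euler_eq, euler_eq, Event.ncard_eq_add, Event.ncard_eq_add R.N]
  push_cast
  -- The preimages under `Event.inl` and `Event.inr` are by definition the right cusps and the
  -- switches of the restrictions.
  exact add_sub_add_comm _ _ _ _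

theorem restrict_injective {R R' : NormalRuling (f.append g)}
    (h₁ : R.restrictLeft = R'.restrictLeft) (h₂ : R.restrictRight = R'.restrictRight) : R = R' := by
  refine ext' (Set.ext fun e => ?_) fun v c => ?_
  · rcases Event.inl_or_inr f g e with ⟨e', rfl⟩ | ⟨e', rfl⟩
    · exact Set.ext_iff.1 (congrArg NormalRuling.N h₁) e'
    · exact Set.ext_iff.1 (congrArg NormalRuling.N h₂) e'
  · rcases Cut.inl_or_inr f g c with ⟨c', rfl⟩ | ⟨c', rfl⟩
    · exact congrArg (fun R : NormalRuling f => R.S c') h₁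
    · exact congrArg (fun R : NormalRuling g => R.S c') h₂

/-- Normal rulings that agree on the common border can be glued. -/
theorem exists_glue (R₁ : NormalRuling f) (R₂ : NormalRuling g) (h : R₁.right = R₂.left) :
    ∃ R : NormalRuling (f.append g), R.restrictLeft = R₁ ∧ R.restrictRight = R₂ := by
  let N : Set (Event (f.append g)) := Event.inl g '' R₁.N ∪ Event.inr f '' R₂.N
  have hl : ∀ e, Event.inl g e ∈ N ↔ e ∈ R₁.N := fun e => by
    refine ⟨?_, fun h => .inl ⟨e, h, rfl⟩⟩
    rintro (⟨e', he', h⟩ | ⟨e', -, h⟩)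
    · exact Event.inl_injective h ▸ he'
    · exact absurd h.symm (Event.inl_ne_inr e e')
  have hr : ∀ e, Event.inr f e ∈ N ↔ e ∈ R₂.N := fun e => by
    refine ⟨?_, fun h => .inr ⟨e, h, rfl⟩⟩
    rintro (⟨e', -, h⟩ | ⟨e', he', h⟩)
    · exact absurd h (Event.inl_ne_inr e' e)
    · exact Event.inr_injective h ▸ he'
  let R : NormalRuling (f.append g) :=
    { N := N
      S := Cut.glue f R₁.S R₂.S
      canSwitch := by
        rintro _ (⟨e, he, rfl⟩ | ⟨e, he, rfl⟩)
        · exact R₁.canSwitch e he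
        · exact R₂.canSwitch e he
      -- The condition involves one event and its two adjacent cuts, which all lie in the same part,
      -- so it is inherited from that part.
      passes := fun e => by
        rcases Event.inl_or_inr f g e with ⟨e, rfl⟩ | ⟨e, rfl⟩
        · rw [hl e]
          simp only [Event.inl, Occ.left_inl, Occ.right_inl, Cut.glue_inl R₁.S R₂.S h]
          exact R₁.passes e
        · rw [hr e]
          simp only [Event.inr, Occ.left_inr, Occ.right_inr, Cut.glue_inr R₁.S R₂.S]
          exact R₂.passes e }
  exact ⟨R, ext' (Set.ext hl) fun v c => Cut.glue_inl R₁.S R₂.S h c,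
    ext' (Set.ext hr) fun v c => Cut.glue_inr R₁.S R₂.S c⟩

/-- This and the next lemmas handle the transport along `Front.resolve_append`, by which a ruling of
the resolution of a concatenation becomes one of a concatenation of resolutions. -/
theorem left_cast {f' : Link s t} (h : f = f') (R : NormalRuling f) : (h ▸ R).left = R.left := by
  subst h; rfl

theorem right_cast {f' : Link s t} (h : f = f') (R : NormalRuling f) :
    (h ▸ R).right = R.right := by
  subst h; rfl

theorem euler_cast {f' : Link s t} (h : f = f') (R : NormalRuling f) :
    (h ▸ R).euler = R.euler := by
  subst h; rfl

theorem exists_cast {f' : Link s t} (h : f = f') (R' : NormalRuling f') :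
    ∃ R : NormalRuling f, h ▸ R = R' := by
  subst h; exact ⟨R', rfl⟩

theorem cast_injective {f' : Link s t} (h : f = f') {R R' : NormalRuling f}
    (he : h ▸ R = h ▸ R') : R = R' := by
  subst h; exact he

end NormalRuling

/-! ## Resolutions of a concatenation of fronts -/

namespace Front
variable {s t u : Border}

/-- With `res_injective`, this says that choices at the vertices of the concatenation are pairs of
choices on the two parts. -/
theorem exists_res (f : Front s t) (g : Front t u) (Φ₁ : f.Res) (Φ₂ : g.Res) :
    ∃ Φ : (f.append g).Res, f.resLeft g Φ = Φ₁ ∧ f.resRight g Φ = Φ₂ := by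
  induction f with
  | nil => exact ⟨Φ₂, rfl, rfl⟩
  | cons c f ih =>
    obtain ⟨Φ, h₁, h₂⟩ := ih g Φ₁.2 Φ₂
    exact ⟨(Φ₁.1, Φ), Prod.ext rfl h₁, h₂⟩

theorem res_injective (f : Front s t) (g : Front t u) {Φ Φ' : (f.append g).Res}
    (h₁ : f.resLeft g Φ = f.resLeft g Φ') (h₂ : f.resRight g Φ = f.resRight g Φ') : Φ = Φ' := by
  induction f with
  | nil => exact h₂
  | cons c f ih =>
    -- Unfolds `Res` and `resLeft` so that the equation can be read as one between pairs.
    have h₁ : ((Φ.1, f.resLeft g Φ.2) : c.Res × f.Res) = (Φ'.1, f.resLeft g Φ'.2) := h₁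
    exact Prod.ext (Prod.mk.inj h₁).1 (ih g (Prod.mk.inj h₁).2 h₂)

theorem index_append (f : Front s t) (g : Front t u) (Φ : (f.append g).Res) :
    (f.append g).index Φ = f.index (f.resLeft g Φ) + g.index (f.resRight g Φ) := by
  induction f with
  | nil => exact (Nat.zero_add _).symm
  | cons c f ih => exact (congrArg (c.index Φ.1 + ·) (ih g Φ.2)).trans (Nat.add_assoc _ _ _).symm

end Front

/-! ## Rulings of a concatenation of fronts -/

namespace Ruling
variable {s t u : Border} {T₁ : Front s t} {T₂ : Front t u}

theorem left_restrictLeft (R : Ruling (T₁.append T₂)) : R.restrictLeft.left = R.left :=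
  (NormalRuling.left_restrictLeft _).trans (NormalRuling.left_cast _ _)

theorem right_restrictRight (R : Ruling (T₁.append T₂)) : R.restrictRight.right = R.right :=
  (NormalRuling.right_restrictRight _).trans (NormalRuling.right_cast _ _)

theorem right_restrictLeft (R : Ruling (T₁.append T₂)) :
    R.restrictLeft.right = R.restrictRight.left :=
  NormalRuling.right_restrictLeft _

/-- Monomials multiply by adding exponents, and both exponents, the index and minus the Euler
characteristic, are additive. -/
theorem weight_append (R : Ruling (T₁.append T₂)) :
    R.weight = R.restrictLeft.weight * R.restrictRight.weight := by
  have h : R.2.euler = R.restrictLeft.2.euler + R.restrictRight.2.euler :=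
    (NormalRuling.euler_cast (T₁.resolve_append T₂ R.1) R.2).symm.trans
      (NormalRuling.euler_append _)
  rw [weight, weight, weight, AddMonoidAlgebra.single_mul_single, mul_one, h,
    Front.index_append, restrictLeft, restrictRight]
  congr 1
  ext <;> push_cast
  · rfl
  · exact neg_add _ _

theorem exists_glue (R₁ : Ruling T₁) (R₂ : Ruling T₂) (h : R₁.right = R₂.left) :
    ∃ R : Ruling (T₁.append T₂), R.restrictLeft = R₁ ∧ R.restrictRight = R₂ := by
  obtain ⟨Φ₁, R₁⟩ := R₁
  obtain ⟨Φ₂, R₂⟩ := R₂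
  -- The resolutions are combined first, so that both rulings live over restrictions of a single
  -- `Φ`; the glued ruling is then carried back along `resolve_append`.
  obtain ⟨Φ, rfl, rfl⟩ := T₁.exists_res T₂ Φ₁ Φ₂
  obtain ⟨R', rfl, rfl⟩ := NormalRuling.exists_glue R₁ R₂ h
  obtain ⟨R, rfl⟩ := NormalRuling.exists_cast (T₁.resolve_append T₂ Φ) R'
  exact ⟨⟨Φ, R⟩, rfl, rfl⟩

theorem restrict_injective {R R' : Ruling (T₁.append T₂)}
    (h₁ : R.restrictLeft = R'.restrictLeft) (h₂ : R.restrictRight = R'.restrictRight) : R = R' := by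
  obtain ⟨Φ, R⟩ := R
  obtain ⟨Φ', R'⟩ := R'
  -- Once the resolutions coincide, the heterogeneous equalities of the second components become
  -- equalities.
  obtain rfl : Φ = Φ' := T₁.res_injective T₂ (congrArg Sigma.fst h₁) (congrArg Sigma.fst h₂)
  have h₁ := eq_of_heq (Sigma.mk.inj h₁).2
  have h₂ := eq_of_heq (Sigma.mk.inj h₂).2
  exact congrArg (Sigma.mk Φ) (NormalRuling.cast_injective _
    (NormalRuling.restrict_injective h₁ h₂))

end Ruling

theorem rulingPolynomial_append {l m r : Border} (T₁ : Front l m) (T₂ : Front m r) (ρL : NR l)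
    (ρR : NR r) : rulingPolynomial (T₁.append T₂) ρL ρR =
      ∑ ρ : NR m, rulingPolynomial T₁ ρL ρ * rulingPolynomial T₂ ρ ρR := by
  simp only [rulingPolynomial, Fintype.sum_mul_sum, ← Fintype.sum_prod_type']
  -- The right side is now one sum over the pull-back: triples of a pairing on the common border and
  -- rulings of the two parts that restrict to it. Restriction is a bijection onto this index set
  -- and preserves weights.
  rw [← Fintype.sum_sigma']
  refine Fintype.sum_bijective (fun R : RulingWith (T₁.append T₂) ρL ρR =>
    (⟨R.1.restrictLeft.right,
      ⟨R.1.restrictLeft, (R.1.left_restrictLeft).trans R.2.1, rfl⟩,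
      ⟨R.1.restrictRight, (R.1.right_restrictLeft).symm, (R.1.right_restrictRight).trans R.2.2⟩⟩ :
      Σ ρ : NR m, RulingWith T₁ ρL ρ × RulingWith T₂ ρ ρR)) ⟨?_, ?_⟩ _ _
    (fun R => R.1.weight_append)
  · intro R R' h
    have h₁ := congrArg (fun x : Σ ρ : NR m, RulingWith T₁ ρL ρ × RulingWith T₂ ρ ρR => x.2.1.1) h
    have h₂ := congrArg (fun x : Σ ρ : NR m, RulingWith T₁ ρL ρ × RulingWith T₂ ρ ρR => x.2.2.1) h
    exact Subtype.ext (Ruling.restrict_injective h₁ h₂)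
  · rintro ⟨ρ, ⟨R₁, hL, h₁⟩, ⟨R₂, h₂, hR⟩⟩
    obtain ⟨R, rfl, rfl⟩ := Ruling.exists_glue R₁ R₂ (h₁.trans h₂.symm)
    -- Replaces the pairing on the common border by the one that the glued ruling induces, after
    -- which the given triple is by definition the image of that ruling.
    subst h₁
    exact ⟨⟨R, R.left_restrictLeft.symm.trans hL, R.right_restrictRight.symm.trans hR⟩, rfl⟩

end LegendrianGraph

/-! ### The pull-back property and the composition formula -/

theorem mainTheorem2 {l m r : Border} (T₁ : Front l m) (T₂ : Front m r) (ρL : NR l) (ρR : NR r) :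
    ((∀ R : RulingWith (T₁.append T₂) ρL ρR,
        R.1.restrictLeft.left = ρL ∧ R.1.restrictRight.right = ρR ∧
          R.1.restrictLeft.right = R.1.restrictRight.left) ∧
      ∀ (R₁ : Ruling T₁) (R₂ : Ruling T₂), R₁.left = ρL → R₂.right = ρR → R₁.right = R₂.left →
        ∃! R : RulingWith (T₁.append T₂) ρL ρR,
          R.1.restrictLeft = R₁ ∧ R.1.restrictRight = R₂) ∧
    rulingPolynomial (T₁.append T₂) ρL ρR =
      ∑ ρ : NR m, rulingPolynomial T₁ ρL ρ * rulingPolynomial T₂ ρ ρR := by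
  refine ⟨⟨fun R => ⟨R.1.left_restrictLeft.trans R.2.1, R.1.right_restrictRight.trans R.2.2,
    R.1.right_restrictLeft⟩, fun R₁ R₂ hL hR h => ?_⟩, rulingPolynomial_append T₁ T₂ ρL ρR⟩
  obtain ⟨R, rfl, rfl⟩ := Ruling.exists_glue R₁ R₂ h
  exact ⟨⟨R, R.left_restrictLeft.symm.trans hL, R.right_restrictRight.symm.trans hR⟩, ⟨rfl, rfl⟩,
    fun R' hR' => Subtype.ext (Ruling.restrict_injective hR'.1 hR'.2)⟩
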